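/- A real matrix is totally non-negative if all its minors are non-negative. Let $\mathrm{HTN}$ denote the set of all $n\times n$ totally non-negative Hankel matrices, over all integers $n\ge 1$ (a Hankel matrix is one of the form $(s_{i+j})$ with $s_k$ real). Let $\mathcal{M}([0,\infty))$ denote the set of moment sequences $\left(\int x^k\,d\mu\right)_{k\ge 0}$ of non-negative measures $\mu$ on $\mathbb{R}$ that are supported on $[0,\infty)$ and have finite moments of all orders. An absolutely monotonic entire function is an entire function whose Taylor coefficients at every point of $(0,\infty)$ are real and non-negative. For a function $F:[0,\infty)\to\mathbb{R}$, the following are equivalent. 1. Applied entrywise, $F$ preserves positive semidefiniteness on $\mathrm{HTN}$; that is, for every $A=(a_{ij})\in\mathrm{HTN}$ the matrix $F[A]:=(F(a_{ij}))$ is positive semidefinite. 2. Applied entrywise, $F$ preserves the set $\mathrm{HTN}$; that is, $F[A]\in\mathrm{HTN}$ for every $A\in\mathrm{HTN}$. 3. Applied entrywise, $F$ sends $\mathcal{M}([0,\infty))$ to itself; that is, $(F(s_k))_{k\ge 0}\in\mathcal{M}([0,\infty))$ for every $(s_k)_{k\ge 0}\in\mathcal{M}([0,\infty))$. 4. The function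 $F$ agrees on $(0,\infty)$ with an absolutely monotonic entire function, and $0\le F(0)\le\lim_{\epsilon\to 0^+}F(\epsilon)$. -/

import Mathlib

open scoped NNReal Topology

/-- A real `m × n` matrix is totally non-negative if all its minors (determinants of square
submatrices, with rows and columns taken in increasing order) are non-negative. -/
def IsTotallyNonneg {m n : ℕ} (A : Matrix (Fin m) (Fin n) ℝ) : Prop :=
  ∀ (k : ℕ) (r : Fin k ↪o Fin m) (c : Fin k ↪o Fin n), 0 ≤ (A.submatrix r c).det

/-- A Hankel matrix: the entry at position `(i, j)` depends only on `i + j`. -/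
def IsHankel {n : ℕ} (A : Matrix (Fin n) (Fin n) ℝ) : Prop :=
  ∃ s : ℕ → ℝ, ∀ i j : Fin n, A i j = s ((i : ℕ) + (j : ℕ))

/-- The set of `n × n` totally non-negative Hankel matrices. -/
def HTN (n : ℕ) : Set (Matrix (Fin n) (Fin n) ℝ) :=
  {A | IsHankel A ∧ IsTotallyNonneg A}

/-- `μ` is a non-negative measure on `ℝ`, supported on `K`, with moments of all orders. -/
structure IsAdmissibleOn (μ : MeasureTheory.Measure ℝ) (K : Set ℝ) : Prop where
  supported : μ Kᶜ = 0
  integrable_pow : ∀ k : ℕ, MeasureTheory.Integrable (fun x : ℝ => x ^ k) μ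

/-- The set of moment sequences of admissible measures supported on `K`. -/
def momentSet (K : Set ℝ) : Set (ℕ → ℝ) :=
  {s | ∃ μ : MeasureTheory.Measure ℝ, IsAdmissibleOn μ K ∧ ∀ k : ℕ, s k = ∫ x, x ^ k ∂μ}

/-- An absolutely monotonic entire function: an entire function all of whose Taylor coefficients
(equivalently, derivatives of every order) at every point of `(0, ∞)` are real and
non-negative. -/
def IsAbsMonotonicEntire (g : ℂ → ℂ) : Prop :=
  Differentiable ℂ g ∧
    ∀ x : ℝ, 0 < x → ∀ n : ℕ,
      (iteratedDeriv n g (x : ℂ)).im = 0 ∧ 0 ≤ (iteratedDeriv n g (x : ℂ)).re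

/-- The entries of a totally non-negative matrix are its `1 × 1` minors, so non-negative. -/
theorem IsTotallyNonneg.entry_nonneg {m n : ℕ} {A : Matrix (Fin m) (Fin n) ℝ}
    (hA : IsTotallyNonneg A) (i : Fin m) (j : Fin n) : 0 ≤ A i j := by
  have h := hA 1 (OrderEmbedding.ofStrictMono (fun _ => i) (Subsingleton.strictMono _))
    (OrderEmbedding.ofStrictMono (fun _ => j) (Subsingleton.strictMono _))
  simpa using h

/-- Moments of measures supported on `[0, ∞)` are non-negative. -/
theorem momentSet.term_nonneg {s : ℕ → ℝ} (hs : s ∈ momentSet (Set.Ici 0)) (k : ℕ) :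
    0 ≤ s k := by
  obtain ⟨μ, hμ, h⟩ := hs
  rw [h k]
  apply MeasureTheory.integral_nonneg_of_ae
  have h0 : ∀ᵐ x ∂μ, x ∈ Set.Ici (0 : ℝ) := MeasureTheory.mem_ae_iff.mpr hμ.supported
  filter_upwards [h0] with x hx
  exact pow_nonneg hx k

/-- `F[A]`: the function `F : [0, ∞) → ℝ` applied to every entry of a matrix with non-negative
entries. -/
def entrywise {m n : ℕ} (F : ℝ≥0 → ℝ) (A : Matrix (Fin m) (Fin n) ℝ) (hA : ∀ i j, 0 ≤ A i j) :
    Matrix (Fin m) (Fin n) ℝ :=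
  Matrix.of fun i j => F ⟨A i j, hA i j⟩

/-- `F[s]`: the function `F : [0, ∞) → ℝ` applied to every term of a non-negative sequence. -/
def termwise (F : ℝ≥0 → ℝ) (s : ℕ → ℝ) (hs : ∀ k, 0 ≤ s k) : ℕ → ℝ :=
  fun k => F ⟨s k, hs k⟩

/-! A Hankel matrix is totally non-negative exactly when it and its shift by one index are positive
semidefinite (`hankel_isTotallyNonneg`, `IsTotallyNonneg.posSemidef`,
`IsTotallyNonneg.hankel_shift_posSemidef`). By the Schur product theorem, power series with
non-negative coefficients therefore preserve `HTN`. On moment sequences, powers correspond to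
multiplicative convolution of measures. A downward jump of `F` at `0` is harmless: a zero entry
forces all entries but the two extreme corners to vanish, and a zero moment forces the measure to
live at `0`.

Conversely, either preservation property need only be tested on the moment sequences `a + b u ^ k`
of `a δ₁ + b δᵤ`. The case `u = 0` makes `F` non-negative and monotone. One-sided mollification
reduces to smooth `f`; a test vector annihilating the low-order terms in `b` shows that every
derivative of `f` is non-negative on `[0, ∞)`, and Bernstein's theorem makes `f` a power series with
non-negative coefficients. Compactness of the coefficients gives the limit
(`exists_powerSeries_of_approx`), which agrees with `F` on `(0, ∞)` but only dominates it at `0`. -/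

/-- The `n × n` Hankel matrix of a sequence. -/
def hankel (s : ℕ → ℝ) (n : ℕ) : Matrix (Fin n) (Fin n) ℝ :=
  Matrix.of fun i j => s ((i : ℕ) + (j : ℕ))

theorem hankel_apply (s : ℕ → ℝ) (n : ℕ) (i j : Fin n) : hankel s n i j = s (i + j) := rfl

theorem hankel_isHermitian (s : ℕ → ℝ) (n : ℕ) : (hankel s n).IsHermitian := by
  ext i j
  simp [hankel_apply, add_comm]

/-! ### Fekete's criterion for positivity of all minors -/

/-- Reduction of a determinant whose first column has no zero entry: normalise the first column
to `1` and take differences of consecutive rows. -/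
theorem det_eq_prod_mul_det_diff {k : ℕ} (V : Matrix (Fin (k + 1)) (Fin (k + 1)) ℝ)
    (hV : ∀ a, V a 0 ≠ 0) :
    V.det = (∏ a, V a 0) * (Matrix.of fun a b : Fin k =>
      V a.succ b.succ / V a.succ 0 - V a.castSucc b.succ / V a.castSucc 0).det := by
  set U : Matrix (Fin (k + 1)) (Fin (k + 1)) ℝ := Matrix.of fun a b => V a b / V a 0 with hU
  have h1 : V.det = (∏ a, V a 0) * U.det := by
    rw [← Matrix.det_mul_column]
    congr 1
    ext a b
    simp only [hU, Matrix.of_apply]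
    rw [mul_div_cancel₀ _ (hV a)]
  set B : Matrix (Fin (k + 1)) (Fin (k + 1)) ℝ :=
    Matrix.of fun a b => Fin.cases (U 0 b) (fun i => U i.succ b - U i.castSucc b) a with hB
  have h2 : U.det = B.det := by
    refine Matrix.det_eq_of_forall_row_eq_smul_add_pred (fun _ => 1) ?_ ?_
    · intro j; simp [hB]
    · intro i j; simp [hB]
  have hU0 : ∀ a, U a 0 = 1 := fun a => by simp [hU, div_self (hV a)]
  rw [h1, h2, Matrix.det_succ_column_zero, Fin.sum_univ_succ]
  congr 1
  have hz : ∀ i : Fin k, B i.succ 0 = 0 := fun i => by simp [hB, hU0]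
  have h0 : B 0 0 = 1 := by simp [hB, hU0]
  simp only [hz, h0]
  simp only [Fin.val_zero, pow_zero, mul_one, one_mul, mul_zero, zero_mul, Finset.sum_const_zero,
    add_zero]
  congr 1

/-- If all minors formed from consecutive rows and initial columns are positive, then so are all
minors formed from arbitrary rows and initial columns. -/
theorem det_rows_pos_of_consecutive (k : ℕ) : ∀ (N : ℕ) (V : ℕ → ℕ → ℝ),
    (∀ m ≤ k, ∀ i, i + m ≤ N → 0 < (Matrix.of fun a b : Fin m => V (i + a) b).det) →
    ∀ r : Fin k → ℕ, StrictMono r → (∀ a, r a < N) →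
      0 < (Matrix.of fun a b : Fin k => V (r a) b).det := by
  induction k with
  | zero => intro N V _ r _ _; simp
  | succ k ih =>
    intro N V hV r hr hrN
    have hpos : ∀ i < N, 0 < V i 0 := by
      intro i hi
      have := hV 1 (by omega) i (by omega)
      simpa using this
    set W : ℕ → ℕ → ℝ := fun i b => V (i + 1) (b + 1) / V (i + 1) 0 - V i (b + 1) / V i 0 with hW
    have hWpos : ∀ m ≤ k, ∀ i, i + m ≤ N - 1 →
        0 < (Matrix.of fun a b : Fin m => W (i + a) b).det := by
      intro m hm i hi
      rcases Nat.eq_zero_or_pos m with rfl | hm0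
      · simp
      have h := hV (m + 1) (by omega) i (by omega)
      have hp : ∀ a : Fin (m + 1), 0 < V (i + a) 0 := fun a => hpos _ (by omega)
      rw [det_eq_prod_mul_det_diff _ (fun a => by simpa using (hp a).ne')] at h
      have hq := pos_of_mul_pos_right h (Finset.prod_nonneg fun a _ => by simpa using (hp a).le)
      refine hq.trans_eq (congrArg Matrix.det ?_)
      ext a b
      simp [hW, add_assoc]
    have hp : ∀ a, 0 < V (r a) 0 := fun a => hpos _ (hrN a)
    rw [det_eq_prod_mul_det_diff _ (fun a => by simpa using (hp a).ne')]
    refine mul_pos (Finset.prod_pos fun a _ => by simpa using hp a) ?_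
    -- Differences of distant normalised rows telescope into rows of `W`. Multilinearity then
    -- expands the determinant into minors of `W` whose row indices lie in successive disjoint
    -- intervals, hence increase strictly.
    have htel : (Matrix.of fun a b : Fin k =>
        (Matrix.of fun a b : Fin (k + 1) => V (r a) b) a.succ b.succ /
          (Matrix.of fun a b : Fin (k + 1) => V (r a) b) a.succ 0 -
        (Matrix.of fun a b : Fin (k + 1) => V (r a) b) a.castSucc b.succ /
          (Matrix.of fun a b : Fin (k + 1) => V (r a) b) a.castSucc 0) =
        fun a => ∑ i ∈ Finset.Ico (r a.castSucc) (r a.succ), fun b : Fin k => W i b := by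
      ext a b
      rw [Finset.sum_apply]
      simp only [Matrix.of_apply, hW]
      rw [Finset.sum_Ico_eq_sub _ (hr (Fin.castSucc_lt_succ)).le]
      rw [Finset.sum_range_sub (fun i => V i (b + 1) / V i 0),
        Finset.sum_range_sub (fun i => V i (b + 1) / V i 0)]
      simp
    rw [htel]
    have hexp := (Matrix.detRowAlternating (R := ℝ) (n := Fin k)).toMultilinearMap.map_sum_finset
      (fun (_ : Fin k) (i : ℕ) => (fun b : Fin k => W i b))
      (fun a => Finset.Ico (r a.castSucc) (r a.succ))
    change 0 < (Matrix.detRowAlternating (R := ℝ) (n := Fin k)).toMultilinearMap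
      (fun a => ∑ i ∈ Finset.Ico (r a.castSucc) (r a.succ), fun b : Fin k => W i b)
    rw [hexp]
    refine Finset.sum_pos ?_ ?_
    · intro f hf
      rw [Fintype.mem_piFinset] at hf
      have hf' : ∀ a, r a.castSucc ≤ f a ∧ f a < r a.succ := fun a => Finset.mem_Ico.1 (hf a)
      refine ih (N - 1) W hWpos f ?_ ?_
      · intro a b hab
        refine (hf' a).2.trans_le (le_trans (hr.monotone ?_) (hf' b).1)
        exact Fin.succ_le_castSucc_iff.2 hab
      · intro a
        have := (hf' a).2
        have := hrN a.succ
        omega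
    · refine ⟨fun a => r a.castSucc, ?_⟩
      rw [Fintype.mem_piFinset]
      intro a
      exact Finset.mem_Ico.2 ⟨le_rfl, hr Fin.castSucc_lt_succ⟩

/-- Fekete's criterion: if all minors formed from consecutive rows and consecutive columns are
positive, then all minors are positive. -/
theorem det_pos_of_consecutive (N : ℕ) (V : ℕ → ℕ → ℝ)
    (hV : ∀ m i j, i + m ≤ N → j + m ≤ N →
      0 < (Matrix.of fun a b : Fin m => V (i + a) (j + b)).det)
    (k : ℕ) (r c : Fin k → ℕ) (hr : StrictMono r) (hc : StrictMono c)
    (hrN : ∀ a, r a < N) (hcN : ∀ a, c a < N) :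
    0 < (Matrix.of fun a b : Fin k => V (r a) (c b)).det := by
  have key : ∀ m (r : Fin m → ℕ) (j : ℕ), StrictMono r → (∀ a, r a < N) → j + m ≤ N →
      0 < (Matrix.of fun a b : Fin m => V (r a) (j + b)).det := by
    intro m r j hr hrN hj
    exact det_rows_pos_of_consecutive m N (fun i b => V i (j + b))
      (fun m' hm' i hi => hV m' i j hi (by omega)) r hr hrN
  -- The same criterion for the transpose, with the rows `r` already chosen. The value `0` for `b ≥
  -- k` is padding that no minor sees.
  have := det_rows_pos_of_consecutive k N
    (fun i b => if h : b < k then V (r ⟨b, h⟩) i else 0) ?_ c hc hcN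
  · rw [← Matrix.det_transpose]
    convert this using 3
    ext a b
    simp
  · intro m hm i hi
    have := key m (fun a => r (Fin.castLE hm a)) i
      (fun a b hab => hr (by simpa using hab)) (fun a => hrN _) hi
    rw [← Matrix.det_transpose] at this
    convert this using 3
    ext a b
    have : (b : ℕ) < k := by omega
    simp [this, Fin.castLE]

/-! ### Total non-negativity and positive semidefiniteness of Hankel matrices -/

/-- By Fekete only contiguous minors matter. One with corner `(i, j)` depends on `i + j` alone: it
is a principal minor of the Hankel matrix if `i + j` is even, and of the shifted one if `i + j` is
odd. -/
theorem hankel_minor_pos {s : ℕ → ℝ} {n : ℕ} (h0 : (hankel s n).PosDef)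
    (h1 : (hankel (fun k => s (k + 1)) (n - 1)).PosDef) (k : ℕ) (r c : Fin k ↪o Fin n) :
    0 < ((hankel s n).submatrix r c).det := by
  refine det_pos_of_consecutive n (fun i j => s (i + j)) ?_ k (fun a => r a) (fun a => c a)
    (fun a b hab => r.strictMono hab) (fun a b hab => c.strictMono hab) (fun a => (r a).2)
    (fun a => (c a).2)
  intro m i j hi hj
  obtain ⟨p, hp | hp⟩ := Nat.even_or_odd' (i + j)
  · have hpm : p + m ≤ n := by omega
    have := (h0.submatrix (e := fun a : Fin m => (⟨p + a, by omega⟩ : Fin n))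
      (fun a b hab => by simpa [Fin.ext_iff] using hab)).det_pos
    refine this.trans_eq (congrArg Matrix.det ?_)
    ext a b
    simp only [Matrix.of_apply, Matrix.submatrix_apply, hankel_apply]
    congr 1; omega
  · rcases Nat.eq_zero_or_pos m with rfl | hm
    · simp
    have hpm : p + m ≤ n - 1 := by omega
    have := (h1.submatrix (e := fun a : Fin m => (⟨p + a, by omega⟩ : Fin (n - 1)))
      (fun a b hab => by simpa [Fin.ext_iff] using hab)).det_pos
    refine this.trans_eq (congrArg Matrix.det ?_)
    ext a b
    simp only [Matrix.of_apply, Matrix.submatrix_apply, hankel_apply]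
    congr 1; omega

/-- The Hankel matrix of a moment sequence with atoms `1, …, n` and positive weights is positive
definite. -/
theorem hankel_sum_pow_posDef (n : ℕ) (w : Fin n → ℝ) (hw : ∀ l, 0 < w l) (m : ℕ) (hm : m ≤ n) :
    (hankel (fun k => ∑ l : Fin n, w l * ((l : ℝ) + 1) ^ k) m).PosDef := by
  refine Matrix.PosDef.of_dotProduct_mulVec_pos (hankel_isHermitian _ _) fun x hx => ?_
  -- The form integrates the square of the polynomial with coefficients `x`. If it vanishes, this
  -- polynomial of degree less than `m` is zero at `n ≥ m` points, so `x = 0` by Vandermonde.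
  have hform : star x ⬝ᵥ ((hankel (fun k => ∑ l : Fin n, w l * ((l : ℝ) + 1) ^ k) m).mulVec x) =
      ∑ l : Fin n, w l * (∑ i, x i * ((l : ℝ) + 1) ^ (i : ℕ)) ^ 2 := by
    simp only [dotProduct, Matrix.mulVec, hankel_apply, star_trivial, Finset.mul_sum,
      Finset.sum_mul, sq]
    rw [Finset.sum_comm' (t' := Finset.univ) (s' := fun _ => Finset.univ) (by simp)]
    rw [Finset.sum_congr rfl fun j _ => Finset.sum_comm, Finset.sum_comm]
    refine Finset.sum_congr rfl fun l _ => Finset.sum_congr rfl fun i _ =>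
      Finset.sum_congr rfl fun j _ => ?_
    ring
  rw [hform]
  by_contra hcon
  have hz := (Finset.sum_eq_zero_iff_of_nonneg (fun l _ => mul_nonneg (hw l).le (sq_nonneg _))).1
    (le_antisymm (not_lt.1 hcon)
      (Finset.sum_nonneg fun l _ => mul_nonneg (hw l).le (sq_nonneg _)))
  have hz' : ∀ l : Fin n, ∑ i, x i * ((l : ℝ) + 1) ^ (i : ℕ) = 0 := fun l => by
    have := hz l (Finset.mem_univ _)
    simpa [(hw l).ne'] using this
  refine hx (Matrix.eq_zero_of_forall_index_sum_mul_pow_eq_zero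
    (f := fun a : Fin m => ((a : ℝ) + 1)) ?_ fun j => ?_)
  · intro a b hab
    have : (a : ℝ) = b := by simpa using hab
    exact Fin.ext (by exact_mod_cast this)
  · have := hz' (Fin.castLE hm j)
    simpa using this

/-- A Hankel matrix is totally non-negative as soon as it and its shift are positive
semidefinite. -/
theorem hankel_isTotallyNonneg {s : ℕ → ℝ} {n : ℕ} (h0 : (hankel s n).PosSemidef)
    (h1 : (hankel (fun k => s (k + 1)) (n - 1)).PosSemidef) :
    IsTotallyNonneg (hankel s n) := by
  intro k r c
  -- Adding `ε h` makes both matrices positive definite, the shift of `h` being the same sum with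
  -- weights `l + 1`; then `ε → 0`.
  set h : ℕ → ℝ := fun k => ∑ l : Fin n, ((l : ℝ) + 1) ^ k with hh
  have hp0 : (hankel h n).PosDef := by
    have := hankel_sum_pow_posDef n (fun _ => 1) (fun _ => one_pos) n le_rfl
    simpa using this
  have hp1 : (hankel (fun k => h (k + 1)) (n - 1)).PosDef := by
    have := hankel_sum_pow_posDef n (fun l => (l : ℝ) + 1) (fun l => by positivity) (n - 1)
      (by omega)
    simpa only [hh, pow_succ'] using this
  have hpos : ∀ ε > 0, 0 < ((hankel (fun k => s k + ε * h k) n).submatrix r c).det := by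
    intro ε hε
    refine hankel_minor_pos ?_ ?_ k r c
    · exact Matrix.PosDef.posSemidef_add h0 (hp0.smul hε)
    · exact Matrix.PosDef.posSemidef_add h1 (hp1.smul hε)
  have hcont : Continuous fun ε : ℝ => ((hankel (fun k => s k + ε * h k) n).submatrix r c).det := by
    refine Continuous.matrix_det ?_
    refine continuous_matrix fun i j => ?_
    simp only [Matrix.submatrix_apply, hankel_apply]
    fun_prop
  have ht := (hcont.tendsto 0).mono_left (nhdsWithin_le_nhds (s := Set.Ioi 0))
  simp only [zero_mul, add_zero] at ht
  refine ge_of_tendsto ht ?_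
  filter_upwards [self_mem_nhdsWithin] with ε hε using (hpos ε hε).le

theorem IsTotallyNonneg.submatrix {m n m' n' : ℕ} {A : Matrix (Fin m) (Fin n) ℝ}
    (hA : IsTotallyNonneg A) (e : Fin m' ↪o Fin m) (f : Fin n' ↪o Fin n) :
    IsTotallyNonneg (A.submatrix e f) := fun k r c => by
  simpa using hA k (r.trans e) (c.trans f)

/-- The coefficients of `det (1 + X A)` are sums of principal minors, and the constant one is `1`.
This excludes negative eigenvalues. -/
theorem IsTotallyNonneg.one_le_det_one_add_smul {n : ℕ} {A : Matrix (Fin n) (Fin n) ℝ}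
    (hA : IsTotallyNonneg A) {t : ℝ} (ht : 0 ≤ t) : 1 ≤ (1 + t • A).det := by
  set P : Polynomial ℝ := (1 + (Polynomial.X : Polynomial ℝ) • A.map Polynomial.C).det with hP
  have heval : P.eval t = (1 + t • A).det := by
    rw [hP, ← Polynomial.coe_evalRingHom, RingHom.map_det]
    congr 1
    ext i j
    by_cases hij : i = j <;> simp [hij, mul_comm t]
  have hcoeff : ∀ k, 0 ≤ P.coeff k := by
    intro k
    rw [hP, Matrix.coeff_det_one_add_X_smul_eq_sum_minors]
    refine Finset.sum_nonneg fun s _ => ?_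
    have h := hA s.card (s.orderEmbOfFin rfl) (s.orderEmbOfFin rfl)
    rw [← Matrix.det_submatrix_equiv_self (s.orderIsoOfFin rfl).toEquiv]
    exact h.trans_eq (congrArg Matrix.det (by ext; rfl))
  have h0 : P.coeff 0 = 1 := by
    rw [hP, Matrix.coeff_det_one_add_X_smul_eq_sum_minors]
    simp
  rw [← heval, Polynomial.eval_eq_sum_range, ← h0]
  have := Finset.single_le_sum (f := fun i => P.coeff i * t ^ i)
    (fun i _ => mul_nonneg (hcoeff i) (pow_nonneg ht i))
    (Finset.mem_range.2 (Nat.succ_pos P.natDegree))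
  simpa using this

/-- A symmetric totally non-negative matrix is positive semidefinite. -/
theorem IsTotallyNonneg.posSemidef {n : ℕ} {A : Matrix (Fin n) (Fin n) ℝ}
    (hA : IsTotallyNonneg A) (hs : A.IsHermitian) : A.PosSemidef := by
  rw [hs.posSemidef_iff_eigenvalues_nonneg]
  intro i
  by_contra hcon
  have hlt : hs.eigenvalues i < 0 := not_le.1 hcon
  -- For this positive `t` the eigenvector lies in the kernel of `1 + t A`.
  have hdet := hA.one_le_det_one_add_smul (t := -(hs.eigenvalues i)⁻¹)
    (by simpa using (inv_lt_zero.2 hlt).le)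
  have hv := hs.mulVec_eigenvectorBasis i
  have hz : (1 + (-(hs.eigenvalues i)⁻¹) • A).det = 0 := by
    refine Matrix.exists_mulVec_eq_zero_iff.1 ⟨⇑(hs.eigenvectorBasis i), ?_, ?_⟩
    · intro h
      exact hs.eigenvectorBasis.orthonormal.ne_zero i (by ext j; exact congrFun h j)
    · rw [Matrix.add_mulVec, Matrix.one_mulVec, Matrix.smul_mulVec, hv, smul_smul,
        neg_mul, inv_mul_cancel₀ hlt.ne]
      simp
  linarith

/-! ### Power series applied entrywise to Hankel matrices -/

theorem hankel_const_posSemidef {c : ℝ} (hc : 0 ≤ c) (n : ℕ) :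
    (hankel (fun _ => c) n).PosSemidef := by
  have h := (Matrix.posSemidef_vecMulVec_self_star (fun _ : Fin n => (1 : ℝ))).smul hc
  convert h using 1
  ext i j
  simp [hankel_apply, Matrix.vecMulVec_apply]

/-- Schur product theorem, iterated from the all-ones matrix. -/
theorem hankel_pow_posSemidef {s : ℕ → ℝ} {n : ℕ} (h : (hankel s n).PosSemidef) (j : ℕ) :
    (hankel (fun k => s k ^ j) n).PosSemidef := by
  induction j with
  | zero => simpa using hankel_const_posSemidef zero_le_one n
  | succ j ih =>
    have e : hankel (fun k => s k ^ (j + 1)) n = (hankel (fun k => s k ^ j) n).hadamard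
        (hankel s n) := by
      ext a b
      simp [hankel_apply, pow_succ]
    rw [e]
    exact ih.hadamard h

/-- The condition `i + 2 ≤ 2 * n` selects the indices that occur in the matrix; convergence
elsewhere is irrelevant. -/
theorem hankel_hasSum_posSemidef {s : ℕ → ℝ} {n : ℕ} (h : (hankel s n).PosSemidef)
    {c : ℕ → ℝ} (hc : ∀ k, 0 ≤ c k) {t : ℕ → ℝ}
    (ht : ∀ i, i + 2 ≤ 2 * n → HasSum (fun k => c k * s i ^ k) (t i)) :
    (hankel t n).PosSemidef := by
  refine Matrix.PosSemidef.of_dotProduct_mulVec_nonneg (hankel_isHermitian _ _) fun x => ?_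
  have hs : HasSum (fun k => star x ⬝ᵥ ((c k • hankel (fun i => s i ^ k) n).mulVec x))
      (star x ⬝ᵥ ((hankel t n).mulVec x)) := by
    simp only [dotProduct, Matrix.mulVec, Matrix.smul_apply, hankel_apply, smul_eq_mul]
    refine hasSum_sum fun i _ => HasSum.mul_left _ (hasSum_sum fun j _ => HasSum.mul_right _ ?_)
    exact ht _ (by omega)
  exact hs.nonneg fun k =>
    (((hankel_pow_posSemidef h k).smul (hc k))).dotProduct_mulVec_nonneg x

/-- The order embedding `a ↦ p + a` of `Fin m` into `Fin n`. -/
def shiftEmb {m n : ℕ} (p : ℕ) (h : p + m ≤ n) : Fin m ↪o Fin n :=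
  OrderEmbedding.ofStrictMono (fun a => ⟨p + a, by omega⟩) fun a b hab =>
    Nat.add_lt_add_left (Fin.lt_def.1 hab) p

@[simp] theorem shiftEmb_val {m n : ℕ} (p : ℕ) (h : p + m ≤ n) (a : Fin m) :
    ((shiftEmb p h a : Fin n) : ℕ) = p + a := rfl

/-! ### Zero entries and the jump at `0` -/

section TotallyNonnegHankel

variable {s : ℕ → ℝ} {n : ℕ}

theorem IsTotallyNonneg.hankel_nonneg (h : IsTotallyNonneg (hankel s n)) {i : ℕ}
    (hi : i + 2 ≤ 2 * n) : 0 ≤ s i := by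
  have := h.entry_nonneg ⟨min i (n - 1), by omega⟩ ⟨i - min i (n - 1), by omega⟩
  rw [hankel_apply] at this
  convert this using 2
  simp

/-- The shift arises by deleting the last row and the first column, so it is again totally
non-negative. -/
theorem IsTotallyNonneg.hankel_shift_posSemidef (h : IsTotallyNonneg (hankel s n)) :
    (hankel (fun k => s (k + 1)) (n - 1)).PosSemidef := by
  rcases Nat.eq_zero_or_pos n with rfl | hn
  · exact Matrix.PosSemidef.of_dotProduct_mulVec_nonneg (hankel_isHermitian _ _) fun x => by
      simp [dotProduct]
  refine IsTotallyNonneg.posSemidef ?_ (hankel_isHermitian _ _)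
  convert h.submatrix (shiftEmb (m := n - 1) 0 (by omega)) (shiftEmb (m := n - 1) 1 (by omega))
    using 1
  ext i j
  simp only [hankel_apply, Matrix.submatrix_apply, shiftEmb_val]
  congr 1; omega

/-- A contiguous `2 × 2` minor with corner entry `s i`. For odd `i` no such minor is principal, so
total non-negativity is really used. Splitting off `min i (n - 2)` keeps both offsets within `n -
2`. -/
theorem IsTotallyNonneg.hankel_sq_le (h : IsTotallyNonneg (hankel s n)) {i : ℕ}
    (hi : i + 4 ≤ 2 * n) : s (i + 1) ^ 2 ≤ s i * s (i + 2) := by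
  have := h 2 (shiftEmb (min i (n - 2)) (by omega)) (shiftEmb (i - min i (n - 2)) (by omega))
  rw [Matrix.det_fin_two] at this
  simp only [Matrix.submatrix_apply, hankel_apply, shiftEmb_val, Fin.val_zero, Fin.val_one] at this
  have e0 : min i (n - 2) + 0 + (i - min i (n - 2) + 0) = i := by omega
  have e1 : min i (n - 2) + 0 + (i - min i (n - 2) + 1) = i + 1 := by omega
  have e2 : min i (n - 2) + 1 + (i - min i (n - 2) + 0) = i + 1 := by omega
  have e3 : min i (n - 2) + 1 + (i - min i (n - 2) + 1) = i + 2 := by omega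
  rw [e0, e1, e2, e3] at this
  linarith [sq (s (i + 1))]

/-- If an entry of a totally non-negative Hankel matrix vanishes, then so do all entries other
than the first and the last one. -/
theorem IsTotallyNonneg.hankel_eq_zero (h : IsTotallyNonneg (hankel s n)) {i j : ℕ}
    (hi : i + 2 ≤ 2 * n) (hs : s i = 0) (hj0 : 1 ≤ j) (hj : j + 3 ≤ 2 * n) : s j = 0 := by
  -- Log-convexity with a zero factor kills the middle term, so a zero spreads to every index having
  -- neighbours on both sides.
  have up : ∀ k, k + 4 ≤ 2 * n → s k = 0 → s (k + 1) = 0 := fun k hk h0 => by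
    have := h.hankel_sq_le hk
    rw [h0, zero_mul] at this
    exact pow_eq_zero_iff two_ne_zero |>.1 (le_antisymm this (sq_nonneg _))
  have down : ∀ k, 1 ≤ k → k + 3 ≤ 2 * n → s (k + 1) = 0 → s k = 0 := fun k hk1 hk h0 => by
    obtain ⟨k, rfl⟩ := Nat.exists_eq_add_of_le' hk1
    have := h.hankel_sq_le (i := k) (by omega)
    rw [h0, mul_zero] at this
    exact pow_eq_zero_iff two_ne_zero |>.1 (le_antisymm this (sq_nonneg _))
  rcases le_total i j with hij | hij
  · induction j, hij using Nat.le_induction with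
    | base => exact hs
    | succ j hij ih =>
      rcases Nat.eq_zero_or_pos j with rfl | hj0
      · obtain rfl : i = 0 := by omega
        exact up 0 (by omega) hs
      · exact up j (by omega) (ih hj0 (by omega))
  · induction i, hij using Nat.le_induction with
    | base => exact hs
    | succ i hij ih => exact ih (by omega) (down i (by omega) (by omega) hs)

/-- A function given on `(0, ∞)` by a power series with non-negative coefficients, with a possible
downward jump at `0`, preserves total non-negativity of Hankel matrices. -/
theorem IsTotallyNonneg.hankel_comp (h : IsTotallyNonneg (hankel s n)) {G : ℝ → ℝ} {c : ℕ → ℝ}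
    (hc : ∀ k, 0 ≤ c k) (hG : ∀ x, 0 < x → HasSum (fun k => c k * x ^ k) (G x))
    (h0 : 0 ≤ G 0) (h0c : G 0 ≤ c 0) : IsTotallyNonneg (hankel (fun k => G (s k)) n) := by
  by_cases hpos : ∀ i, i + 2 ≤ 2 * n → 0 < s i
  · exact hankel_isTotallyNonneg
      (hankel_hasSum_posSemidef (h.posSemidef (hankel_isHermitian _ _)) hc
        fun i hi => hG _ (hpos i hi))
      (hankel_hasSum_posSemidef h.hankel_shift_posSemidef hc
        fun i hi => hG _ (hpos (i + 1) (by omega)))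
  · push Not at hpos
    obtain ⟨i, hi, hsi⟩ := hpos
    have hz : ∀ j, 1 ≤ j → j + 3 ≤ 2 * n → s j = 0 := fun j =>
      h.hankel_eq_zero hi (le_antisymm hsi (h.hankel_nonneg hi))
    have hle : ∀ x, 0 ≤ x → G 0 ≤ G x := by
      intro x hx
      rcases hx.eq_or_lt with rfl | hx
      · exact le_rfl
      · have := (hG x hx).tsum_eq ▸ (hG x hx).summable.le_tsum 0
          (fun k _ => mul_nonneg (hc k) (pow_nonneg hx.le k))
        exact h0c.trans (by simpa using this)
    refine hankel_isTotallyNonneg ?_ ?_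
    -- Only the two extreme corners can be non-zero, and both are diagonal. The image is thus a
    -- non-negative constant matrix plus a non-negative diagonal one, and its shift is constant.
    · have hd : hankel (fun k => G (s k)) n = hankel (fun _ => G 0) n +
          Matrix.diagonal (fun i : Fin n => G (s (i + i)) - G 0) := by
        ext i j
        rw [Matrix.add_apply, hankel_apply, hankel_apply]
        by_cases hij : i = j
        · subst hij; simp
        · have : (i : ℕ) ≠ j := fun h => hij (Fin.ext h)
          rw [Matrix.diagonal_apply_ne _ hij, hz _ (by omega) (by omega), add_zero]
      rw [hd]
      refine (hankel_const_posSemidef h0 n).add (Matrix.PosSemidef.diagonal fun i => ?_)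
      exact sub_nonneg.2 (hle _ (h.hankel_nonneg (by omega)))
    · have hd : hankel (fun k => G (s (k + 1))) (n - 1) = hankel (fun _ => G 0) (n - 1) := by
        ext i j
        rw [hankel_apply, hankel_apply, hz _ (by omega) (by omega)]
      rw [hd]
      exact hankel_const_posSemidef h0 _

end TotallyNonnegHankel

/-! ### The entrywise action on `HTN` -/

theorem HTN.exists_eq_hankel {n : ℕ} {A : Matrix (Fin n) (Fin n) ℝ} (hA : A ∈ HTN n) :
    ∃ s, A = hankel s n := by
  obtain ⟨⟨s, hs⟩, _⟩ := hA
  exact ⟨s, by ext i j; exact hs i j⟩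

theorem entrywise_hankel (F : ℝ≥0 → ℝ) (s : ℕ → ℝ) (n : ℕ) (h : ∀ i j, 0 ≤ hankel s n i j) :
    entrywise F (hankel s n) h = hankel (fun k => F (s k).toNNReal) n := by
  ext i j
  rw [hankel_apply, entrywise, Matrix.of_apply]
  congr 1
  exact (Real.toNNReal_of_nonneg (h i j)).symm

theorem hankel_mem_HTN {s : ℕ → ℝ} {n : ℕ} (h : IsTotallyNonneg (hankel s n)) :
    hankel s n ∈ HTN n := ⟨⟨s, fun _ _ => rfl⟩, h⟩

/-- Power series with non-negative coefficients preserve `HTN`. -/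
theorem entrywise_mem_HTN {F : ℝ≥0 → ℝ} {c : ℕ → ℝ} (hc : ∀ k, 0 ≤ c k)
    (hF : ∀ x : ℝ≥0, 0 < x → HasSum (fun k => c k * (x : ℝ) ^ k) (F x))
    (h0 : 0 ≤ F 0) (h0c : F 0 ≤ c 0) {n : ℕ} (A : Matrix (Fin n) (Fin n) ℝ) (hA : A ∈ HTN n) :
    entrywise F A hA.2.entry_nonneg ∈ HTN n := by
  obtain ⟨s, rfl⟩ := HTN.exists_eq_hankel hA
  rw [entrywise_hankel]
  refine hankel_mem_HTN (hA.2.hankel_comp (G := fun x => F x.toNNReal) hc (fun x hx => ?_)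
    (by simpa using h0) (by simpa using h0c))
  have := hF x.toNNReal (by simpa using hx)
  rwa [Real.coe_toNNReal _ hx.le] at this

theorem posSemidef_of_mem_HTN {n : ℕ} {A : Matrix (Fin n) (Fin n) ℝ} (hA : A ∈ HTN n) :
    A.PosSemidef := by
  obtain ⟨s, rfl⟩ := HTN.exists_eq_hankel hA
  exact hA.2.posSemidef (hankel_isHermitian _ _)

/-! ### The termwise action on moment sequences -/

section Moments

open MeasureTheory ENNReal

/-- Moment sequences of measures supported on `[0, ∞)`, in terms of measures on `ℝ≥0`. -/
theorem mem_momentSet_Ici_iff {s : ℕ → ℝ} :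
    s ∈ momentSet (Set.Ici 0) ↔ (∀ k, 0 ≤ s k) ∧
      ∃ ν : Measure ℝ≥0, ∀ k, ∫⁻ x, (x : ℝ≥0∞) ^ k ∂ν = ENNReal.ofReal (s k) := by
  constructor
  · intro hs
    refine ⟨momentSet.term_nonneg hs, ?_⟩
    obtain ⟨μ, hμ, h⟩ := hs
    have h0 : ∀ᵐ x ∂μ, 0 ≤ x := mem_ae_iff.mpr hμ.supported
    refine ⟨μ.map Real.toNNReal, fun k => ?_⟩
    rw [lintegral_map (by fun_prop) (by fun_prop), h k,
      ofReal_integral_eq_lintegral_ofReal (hμ.integrable_pow k)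
        (h0.mono fun x hx => pow_nonneg hx k)]
    exact lintegral_congr_ae (h0.mono fun x hx => (ENNReal.ofReal_pow hx k).symm)
  · rintro ⟨hs, ν, hν⟩
    have hlin : ∀ k, ∫⁻ x : ℝ≥0, ENNReal.ofReal ((x : ℝ) ^ k) ∂ν = ENNReal.ofReal (s k) := by
      intro k
      rw [← hν k]
      refine lintegral_congr fun x => ?_
      rw [ENNReal.ofReal_pow x.coe_nonneg, ENNReal.ofReal_coe_nnreal]
    refine ⟨ν.map ((↑) : ℝ≥0 → ℝ), ⟨?_, fun k => ?_⟩, fun k => ?_⟩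
    · rw [Measure.map_apply (by fun_prop) measurableSet_Ici.compl]
      convert measure_empty (μ := ν)
      ext x
      simp
    · rw [integrable_map_measure (by fun_prop) (by fun_prop)]
      refine ⟨by fun_prop, ?_⟩
      rw [hasFiniteIntegral_iff_ofReal (Filter.Eventually.of_forall fun x => by simp)]
      exact (hlin k).trans_lt ENNReal.ofReal_lt_top
    · rw [integral_map (by fun_prop) (by fun_prop), integral_eq_lintegral_of_nonneg_ae
        (Filter.Eventually.of_forall fun x => by simp) (by fun_prop), hlin k,
        ENNReal.toReal_ofReal (hs k)]

/-- Multiplicative convolution of measures multiplies moments, as for products of independent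
variables; the start is `δ₁`, with all moments `1`. -/
theorem momentSet_pow {ν : Measure ℝ≥0} {s : ℕ → ℝ} (hs : ∀ k, 0 ≤ s k)
    (hν : ∀ k, ∫⁻ x, (x : ℝ≥0∞) ^ k ∂ν = ENNReal.ofReal (s k)) (j : ℕ) :
    ∃ ρ : Measure ℝ≥0, ∀ k, ∫⁻ x, (x : ℝ≥0∞) ^ k ∂ρ = ENNReal.ofReal (s k ^ j) := by
  have : IsFiniteMeasure ν := ⟨by
    have := hν 0
    simp only [pow_zero, lintegral_one] at this
    rw [this]
    exact ENNReal.ofReal_lt_top⟩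
  induction j with
  | zero => exact ⟨Measure.dirac 1, fun k => by simp⟩
  | succ j ih =>
    obtain ⟨ρ, hρ⟩ := ih
    refine ⟨ρ.mconv ν, fun k => ?_⟩
    rw [Measure.lintegral_mconv (by fun_prop)]
    simp only [ENNReal.coe_mul, mul_pow]
    simp_rw [lintegral_const_mul' _ _ (ENNReal.pow_ne_top ENNReal.coe_ne_top)]
    rw [lintegral_mul_const _ (by fun_prop), hρ, hν, ← ENNReal.ofReal_mul (pow_nonneg (hs k) j),
      pow_succ]

theorem termwise_apply (F : ℝ≥0 → ℝ) {s : ℕ → ℝ} (hs : ∀ k, 0 ≤ s k) (k : ℕ) :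
    termwise F s hs k = F (s k).toNNReal :=
  congrArg F (Real.toNNReal_of_nonneg (hs k)).symm

/-- Power series with non-negative coefficients, with a possible downward jump at `0`, transform
moment sequences into moment sequences. -/
theorem termwise_mem_momentSet {F : ℝ≥0 → ℝ} {c : ℕ → ℝ} (hc : ∀ k, 0 ≤ c k)
    (hF : ∀ x : ℝ≥0, 0 < x → HasSum (fun k => c k * (x : ℝ) ^ k) (F x))
    (h0 : 0 ≤ F 0) (h0c : F 0 ≤ c 0) (s : ℕ → ℝ) (hs : s ∈ momentSet (Set.Ici 0)) :
    termwise F s (momentSet.term_nonneg hs) ∈ momentSet (Set.Ici 0) := by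
  have hle : ∀ x, F 0 ≤ F x := by
    intro x
    rcases (bot_le (a := x)).eq_or_lt with rfl | hx
    · exact le_rfl
    · have := (hF x hx).tsum_eq ▸ (hF x hx).summable.le_tsum 0
        (fun k _ => mul_nonneg (hc k) (pow_nonneg x.coe_nonneg k))
      exact h0c.trans (by simpa using this)
  obtain ⟨hs0, ν, hν⟩ := mem_momentSet_Ici_iff.1 hs
  refine mem_momentSet_Ici_iff.2 ⟨fun k => h0.trans (hle _), ?_⟩
  by_cases hpos : ∀ k, 0 < s k
  · choose ρ hρ using momentSet_pow hs0 hν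
    refine ⟨Measure.sum fun j => ENNReal.ofReal (c j) • ρ j, fun k => ?_⟩
    have hsum := hF (s k).toNNReal (by simpa using hpos k)
    rw [Real.coe_toNNReal _ (hs0 k)] at hsum
    rw [lintegral_sum_measure]
    simp only [lintegral_smul_measure, hρ, smul_eq_mul]
    rw [termwise_apply, ← hsum.tsum_eq, ENNReal.ofReal_tsum_of_nonneg
      (fun j => mul_nonneg (hc j) (pow_nonneg (hs0 k) j)) hsum.summable]
    refine tsum_congr fun j => ?_
    rw [ENNReal.ofReal_mul (hc j)]
  · push Not at hpos
    obtain ⟨i, hi⟩ := hpos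
    -- A vanishing moment forces `x = 0` almost everywhere, so all moments of positive order vanish.
    have hae : ∀ᵐ x : ℝ≥0 ∂ν, (x : ℝ≥0∞) ^ i = 0 := by
      have := hν i
      rw [ENNReal.ofReal_of_nonpos hi, lintegral_eq_zero_iff (by fun_prop)] at this
      exact this
    have hz : ∀ k, s (k + 1) = 0 := by
      intro k
      refine le_antisymm (ENNReal.ofReal_eq_zero.1 ?_) (hs0 _)
      rw [← hν, lintegral_eq_zero_iff (by fun_prop)]
      filter_upwards [hae] with x hx
      have : (x : ℝ≥0∞) = 0 := eq_zero_of_pow_eq_zero hx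
      simp [this]
    -- The atom at `1` gives every moment the value `F 0`; the atom at `0` affects only the total
    -- mass and raises it to `F (s 0)`.
    refine ⟨ENNReal.ofReal (F 0) • Measure.dirac 1 +
      ENNReal.ofReal (F (s 0).toNNReal - F 0) • Measure.dirac 0, fun k => ?_⟩
    rw [lintegral_add_measure, lintegral_smul_measure, lintegral_smul_measure,
      lintegral_dirac, lintegral_dirac]
    cases k with
    | zero =>
      simp only [pow_zero, smul_eq_mul, mul_one, termwise_apply]
      rw [← ENNReal.ofReal_add h0 (sub_nonneg.2 (hle _))]
      simp
    | succ k =>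
      have : termwise F s (momentSet.term_nonneg hs) (k + 1) = F 0 := by
        rw [termwise_apply, hz k, Real.toNNReal_zero]
      rw [this]
      simp

end Moments

/-! ### Absolutely monotonic entire functions as power series -/

section Entire

open Filter

theorem IsAbsMonotonicEntire.continuous_iteratedDeriv {g : ℂ → ℂ} (hg : IsAbsMonotonicEntire g) (n : ℕ) :
    Continuous (iteratedDeriv n g) :=
  (hg.1.contDiff (n := ⊤)).continuous_iteratedDeriv n le_top

/-- The conditions at `x > 0` are closed and pass to `0` by continuity. -/
theorem IsAbsMonotonicEntire.iteratedDeriv_zero {g : ℂ → ℂ} (hg : IsAbsMonotonicEntire g) (n : ℕ) :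
    (iteratedDeriv n g 0).im = 0 ∧ 0 ≤ (iteratedDeriv n g 0).re := by
  have hcont : Continuous fun x : ℝ => iteratedDeriv n g (x : ℂ) :=
    (hg.continuous_iteratedDeriv n).comp Complex.continuous_ofReal
  have ht : Tendsto (fun x : ℝ => iteratedDeriv n g (x : ℂ)) (𝓝[>] 0)
      (𝓝 (iteratedDeriv n g ((0 : ℝ) : ℂ))) := (hcont.tendsto 0).mono_left nhdsWithin_le_nhds
  rw [Complex.ofReal_zero] at ht
  constructor
  · refine tendsto_nhds_unique ((Complex.continuous_im.tendsto _).comp ht) ?_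
    refine tendsto_const_nhds.congr' ?_
    filter_upwards [self_mem_nhdsWithin] with x hx using (hg.2 x hx n).1.symm
  · refine ge_of_tendsto ((Complex.continuous_re.tendsto _).comp ht) ?_
    filter_upwards [self_mem_nhdsWithin] with x hx using (hg.2 x hx n).2

/-- On the real line an absolutely monotonic entire function is the sum of a power series with
non-negative coefficients. -/
theorem IsAbsMonotonicEntire.exists_hasSum {g : ℂ → ℂ} (hg : IsAbsMonotonicEntire g) :
    ∃ c : ℕ → ℝ, (∀ k, 0 ≤ c k) ∧ c 0 = (g 0).re ∧
      ∀ x : ℝ, HasSum (fun k => c k * x ^ k) (g x).re := by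
  refine ⟨fun k => (k.factorial : ℝ)⁻¹ * (iteratedDeriv k g 0).re,
    fun k => mul_nonneg (by positivity) (hg.iteratedDeriv_zero k).2, by simp, fun x => ?_⟩
  have h := ((Complex.hasSum_iff _ _).1 (Complex.hasSum_taylorSeries_of_entire hg.1 0 x)).1
  convert h using 2 with k
  have e : iteratedDeriv k g 0 = (((iteratedDeriv k g 0).re : ℝ) : ℂ) :=
    Complex.ext rfl (by simpa using (hg.iteratedDeriv_zero k).1)
  rw [e]
  have : ((k.factorial : ℂ)⁻¹ • ((x : ℂ) - 0) ^ k • (((iteratedDeriv k g 0).re : ℝ) : ℂ)) =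
      (((k.factorial : ℝ)⁻¹ * (x ^ k * (iteratedDeriv k g 0).re) : ℝ) : ℂ) := by
    simp
  rw [this, Complex.ofReal_re]
  ring

/-- An entire function with non-negative Taylor coefficients at `0` is absolutely monotonic. -/
theorem isAbsMonotonicEntire_of_iteratedDeriv_zero {g : ℂ → ℂ} (hg : Differentiable ℂ g)
    (h0 : ∀ n, (iteratedDeriv n g 0).im = 0 ∧ 0 ≤ (iteratedDeriv n g 0).re) :
    IsAbsMonotonicEntire g := by
  refine ⟨hg, fun x hx n => ?_⟩
  have hd : Differentiable ℂ (iteratedDeriv n g) :=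
    (hg.contDiff (n := ⊤)).differentiable_iteratedDeriv n (WithTop.coe_lt_top _)
  have h := Complex.hasSum_taylorSeries_of_entire hd 0 x
  have hterm : ∀ k : ℕ, ((k.factorial : ℂ)⁻¹ • ((x : ℂ) - 0) ^ k •
      iteratedDeriv k (iteratedDeriv n g) 0) =
      (((k.factorial : ℝ)⁻¹ * (x ^ k * (iteratedDeriv (k + n) g 0).re) : ℝ) : ℂ) := by
    intro k
    have e : iteratedDeriv (k + n) g 0 = (((iteratedDeriv (k + n) g 0).re : ℝ) : ℂ) :=
      Complex.ext rfl (by simpa using (h0 (k + n)).1)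
    have e' : iteratedDeriv k (iteratedDeriv n g) 0 = iteratedDeriv (k + n) g 0 := by
      simp only [iteratedDeriv_eq_iterate, Function.iterate_add_apply]
    rw [e', e]
    simp
  simp_rw [hterm] at h
  obtain ⟨hre, him⟩ := (Complex.hasSum_iff _ _).1 h
  simp only [Complex.ofReal_re] at hre
  simp only [Complex.ofReal_im] at him
  refine ⟨him.unique hasSum_zero, hre.nonneg fun k => ?_⟩
  exact mul_nonneg (by positivity) (mul_nonneg (by positivity) (h0 _).2)

/-- A power series with non-negative coefficients that converges on `[0, ∞)` is an absolutely
monotonic entire function. -/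
theorem exists_isAbsMonotonicEntire_of_summable {c : ℕ → ℝ} (hc : ∀ k, 0 ≤ c k)
    (hs : ∀ x : ℝ, 0 ≤ x → Summable fun k => c k * x ^ k) :
    ∃ g : ℂ → ℂ, IsAbsMonotonicEntire g ∧ ∀ x : ℝ, 0 ≤ x → g x = ((∑' k, c k * x ^ k : ℝ) : ℂ) := by
  set g : ℂ → ℂ := fun z => ∑' k, (c k : ℂ) * z ^ k with hgdef
  have hsz : ∀ z : ℂ, Summable fun k => (c k : ℂ) * z ^ k := fun z => by
    refine Summable.of_norm ?_
    convert hs ‖z‖ (norm_nonneg z) using 2 with k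
    simp [abs_of_nonneg (hc k)]
  have hg : Differentiable ℂ g := by
    intro z
    have : DifferentiableOn ℂ g (Metric.ball 0 (‖z‖ + 1)) := by
      refine Complex.differentiableOn_tsum_of_summable_norm (hs (‖z‖ + 1) (by positivity))
        (fun k => by fun_prop) Metric.isOpen_ball fun k w hw => ?_
      rw [norm_mul, norm_pow, Complex.norm_real, Real.norm_of_nonneg (hc k)]
      refine mul_le_mul_of_nonneg_left (pow_le_pow_left₀ (norm_nonneg w) ?_ k) (hc k)
      exact (mem_ball_zero_iff.1 hw).le
    exact this.differentiableAt (Metric.isOpen_ball.mem_nhds (by simp))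
  have hp : HasFPowerSeriesAt g (FormalMultilinearSeries.ofScalars ℂ fun k => (c k : ℂ)) 0 := by
    rw [hasFPowerSeriesAt_iff]
    refine Eventually.of_forall fun z => ?_
    simp only [FormalMultilinearSeries.coeff_ofScalars, zero_add, smul_eq_mul]
    simpa only [mul_comm] using (hsz z).hasSum
  have hcoef : ∀ k, iteratedDeriv k g 0 = ((c k * k.factorial : ℝ) : ℂ) := by
    intro k
    -- Uniqueness of the power series identifies the Taylor coefficients with `c`.
    have h := FormalMultilinearSeries.ofScalars_series_injective ℂ ℂ
      ((hg.analyticAt 0).hasFPowerSeriesAt.eq_formalMultilinearSeries hp)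
    have hk := congrFun h k
    have hne : (k.factorial : ℂ) ≠ 0 := by exact_mod_cast k.factorial_ne_zero
    rw [div_eq_iff hne] at hk
    rw [hk]
    push_cast
    rfl
  refine ⟨g, isAbsMonotonicEntire_of_iteratedDeriv_zero hg fun n => ?_, fun x _ => ?_⟩
  · rw [hcoef, Complex.ofReal_im, Complex.ofReal_re]
    exact ⟨rfl, mul_nonneg (hc n) (by positivity)⟩
  · rw [Complex.ofReal_tsum]
    simp [hgdef]

end Entire

/-! ### Bernstein's theorem and non-negativity of derivatives -/

section Bernstein

open Filter
open scoped ContDiff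

/-- Taylor's theorem with Lagrange remainder for a smooth function on the line. -/
theorem ContDiff.exists_taylor_lagrange {f : ℝ → ℝ} (hf : ContDiff ℝ ∞ f) {a x : ℝ} (hax : a < x)
    (n : ℕ) : ∃ ξ ∈ Set.Ioo a x, f x =
      ∑ k ∈ Finset.range (n + 1), iteratedDeriv k f a / k.factorial * (x - a) ^ k +
        iteratedDeriv (n + 1) f ξ / (n + 1).factorial * (x - a) ^ (n + 1) := by
  have hsm : ∀ k : ℕ, ContDiff ℝ k f := fun k => hf.of_le (by exact_mod_cast le_top)
  obtain ⟨ξ, hξ, h⟩ := taylor_mean_remainder_lagrange_iteratedDeriv hax.ne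
    (by exact_mod_cast (hsm (n + 1)).contDiffOn : ContDiffOn ℝ (n + 1) f (Set.uIcc a x))
  rw [Set.uIoo_of_lt hax] at hξ
  refine ⟨ξ, hξ, ?_⟩
  rw [sub_eq_iff_eq_add', taylor_within_apply] at h
  rw [h]
  congr 1
  · refine Finset.sum_congr rfl fun k _ => ?_
    rw [iteratedDerivWithin_eq_iteratedDeriv (uniqueDiffOn_uIcc hax.ne) (hsm k).contDiffAt
      Set.left_mem_uIcc, smul_eq_mul]
    ring
  · ring

/-- The first non-vanishing derivative at `0` of a function non-negative on `[0, ∞)` is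
non-negative. -/
theorem ContDiff.iteratedDeriv_nonneg_of_nonneg {h : ℝ → ℝ} (hh : ContDiff ℝ ∞ h)
    (hpos : ∀ b, 0 ≤ b → 0 ≤ h b) (m : ℕ) (hz : ∀ r < m, iteratedDeriv r h 0 = 0) :
    0 ≤ iteratedDeriv m h 0 := by
  cases m with
  | zero => simpa using hpos 0 le_rfl
  | succ m =>
    by_contra hcon
    have hlt := not_le.1 hcon
    have hcont : Continuous (iteratedDeriv (m + 1) h) :=
      hh.continuous_iteratedDeriv _ (by exact_mod_cast le_top)
    obtain ⟨ε, hε, hball⟩ := Metric.eventually_nhds_iff.1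
      (hcont.continuousAt.eventually_lt_const hlt)
    obtain ⟨ξ, hξ, hT⟩ := hh.exists_taylor_lagrange (half_pos hε) m
    rw [Finset.sum_eq_zero fun r hr => by rw [hz r (Finset.mem_range.1 hr)]; simp, zero_add] at hT
    have hneg : iteratedDeriv (m + 1) h ξ < 0 := hball (by
      rw [Real.dist_eq, sub_zero, abs_of_pos hξ.1]
      linarith [hξ.2])
    have h1 : iteratedDeriv (m + 1) h ξ / (m + 1).factorial * (ε / 2 - 0) ^ (m + 1) < 0 :=
      mul_neg_of_neg_of_pos (div_neg_of_neg_of_pos hneg (by positivity))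
        (by rw [sub_zero]; positivity)
    have h2 := hpos (ε / 2) (half_pos hε).le
    linarith

/-- Bernstein: a smooth function on the line, all of whose derivatives are non-negative on
`[0, ∞)`, is there the sum of its Taylor series at `0`. -/
theorem ContDiff.hasSum_taylor_of_iteratedDeriv_nonneg {f : ℝ → ℝ} (hf : ContDiff ℝ ∞ f)
    (hpos : ∀ n x, 0 ≤ x → 0 ≤ iteratedDeriv n f x) {x : ℝ} (hx : 0 ≤ x) :
    HasSum (fun k => iteratedDeriv k f 0 / k.factorial * x ^ k) (f x) := by
  rcases hx.eq_or_lt with rfl | hx0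
  · convert hasSum_single (f := fun k => iteratedDeriv k f 0 / k.factorial * (0 : ℝ) ^ k) 0 ?_
    · simp
    · intro k hk
      simp [hk]
  have hterm : ∀ n a y, 0 ≤ a → 0 ≤ y → 0 ≤ iteratedDeriv n f a / n.factorial * y ^ n :=
    fun n a y ha hy => mul_nonneg (div_nonneg (hpos n a ha) (by positivity)) (pow_nonneg hy n)
  have hmono : ∀ n, MonotoneOn (iteratedDeriv n f) (Set.Ici 0) := by
    intro n
    have hd : Differentiable ℝ (iteratedDeriv n f) :=
      hf.differentiable_iteratedDeriv n (by exact_mod_cast WithTop.coe_lt_top n)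
    refine monotoneOn_of_deriv_nonneg (convex_Ici 0) hd.continuous.continuousOn
      hd.differentiableOn fun y hy => ?_
    rw [← iteratedDeriv_succ]
    exact hpos _ _ (interior_subset hy)
  -- Expanding at `x` and evaluating at `3 * x`, each term with increment `2 * x` is at most `f (3 *
  -- x)`; halving the increment gains `(1 / 2) ^ (n + 1)`. As derivatives increase, this term bounds
  -- the Lagrange remainder at `0`.
  have hbound : ∀ n, iteratedDeriv (n + 1) f x / (n + 1).factorial * x ^ (n + 1) ≤
      f (3 * x) * (1 / 2) ^ (n + 1) := by
    intro n
    obtain ⟨ξ, hξ, hT⟩ := hf.exists_taylor_lagrange (show x < 3 * x by linarith) (n + 1)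
    have h1 : iteratedDeriv (n + 1) f x / (n + 1).factorial * (3 * x - x) ^ (n + 1) ≤
        f (3 * x) := by
      rw [hT]
      refine le_add_of_le_of_nonneg ?_ (hterm _ _ _ (by linarith [hξ.1]) (by linarith))
      exact Finset.single_le_sum
        (f := fun k => iteratedDeriv k f x / k.factorial * (3 * x - x) ^ k)
        (fun k _ => hterm _ _ _ hx (by linarith)) (Finset.self_mem_range_succ _)
    calc _ = iteratedDeriv (n + 1) f x / (n + 1).factorial * (3 * x - x) ^ (n + 1) *
          (1 / 2) ^ (n + 1) := by
            rw [mul_assoc, ← mul_pow]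
            congr 2
            ring
      _ ≤ _ := mul_le_mul_of_nonneg_right h1 (by positivity)
  rw [hasSum_iff_tendsto_nat_of_nonneg fun k => hterm k 0 x le_rfl hx]
  rw [← tendsto_add_atTop_iff_nat 1]
  have hlim : Tendsto (fun n : ℕ => f x - f (3 * x) * (1 / 2 : ℝ) ^ (n + 1)) atTop (𝓝 (f x)) := by
    have := (((tendsto_pow_atTop_nhds_zero_of_lt_one (r := (1 / 2 : ℝ)) (by norm_num)
      (by norm_num)).comp (tendsto_add_atTop_nat 1)).const_mul (f (3 * x))).const_sub (f x)
    simpa using this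
  refine tendsto_of_tendsto_of_tendsto_of_le_of_le hlim tendsto_const_nhds ?_ ?_
  · intro n
    obtain ⟨ξ, hξ, hT⟩ := hf.exists_taylor_lagrange hx0 n
    simp only [sub_zero] at hT
    have : iteratedDeriv (n + 1) f ξ / (n + 1).factorial * x ^ (n + 1) ≤
        iteratedDeriv (n + 1) f x / (n + 1).factorial * x ^ (n + 1) := by
      have := hmono (n + 1) (Set.mem_Ici.2 hξ.1.le) (Set.mem_Ici.2 hx) hξ.2.le
      gcongr
    have := hbound n
    simp only
    linarith
  · intro n
    obtain ⟨ξ, hξ, hT⟩ := hf.exists_taylor_lagrange hx0 n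
    simp only [sub_zero] at hT
    have := hterm (n + 1) ξ x hξ.1.le hx
    simp only
    linarith

/-- A smooth function that preserves positive semidefiniteness of the Hankel matrices of the
sequences `a + b u ^ k` has non-negative derivatives. -/
theorem ContDiff.iteratedDeriv_nonneg_of_hankel {f : ℝ → ℝ} (hf : ContDiff ℝ ∞ f) {u : ℝ}
    (hu0 : 0 < u) (hu1 : u < 1) {a : ℝ}
    (h : ∀ b, 0 ≤ b → ∀ n, (hankel (fun k => f (a + b * u ^ k)) n).PosSemidef) (m : ℕ) :
    0 ≤ iteratedDeriv m f a := by
  -- The coefficients of `q` are the test vector. The quadratic form `H b` has `r`-th derivative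
  -- `f⁽ʳ⁾(a) q(uʳ)²` at `0`. It vanishes for `r < m` by the choice of roots, so order `m` decides
  -- the sign.
  set q : Polynomial ℝ := ∏ j ∈ Finset.range m, (Polynomial.X - Polynomial.C (u ^ j)) with hq
  have hqdeg : q.natDegree < m + 1 := by
    rw [hq, Polynomial.natDegree_prod_of_monic _ _ fun j _ => Polynomial.monic_X_sub_C _]
    simp only [Polynomial.natDegree_X_sub_C]
    simp
  have hq0 : ∀ r < m, q.eval (u ^ r) = 0 := fun r hr => by
    rw [hq, Polynomial.eval_prod]
    exact Finset.prod_eq_zero (Finset.mem_range.2 hr) (by simp)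
  have hqm : q.eval (u ^ m) ≠ 0 := by
    rw [hq, Polynomial.eval_prod, Finset.prod_ne_zero_iff]
    intro j hj
    have := pow_lt_pow_right_of_lt_one₀ hu0 hu1 (Finset.mem_range.1 hj)
    simp only [Polynomial.eval_sub, Polynomial.eval_X, Polynomial.eval_C]
    exact (sub_neg.2 this).ne
  have hqe : ∀ y, q.eval y = ∑ i : Fin (m + 1), q.coeff i * y ^ (i : ℕ) := fun y => by
    rw [Polynomial.eval_eq_sum_range' hqdeg, Finset.sum_range]
  set H : ℝ → ℝ := fun b => ∑ i : Fin (m + 1), ∑ j : Fin (m + 1),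
    q.coeff i * q.coeff j * f (a + u ^ ((i : ℕ) + j) * b) with hH
  have hsm : ContDiff ℝ ∞ H := by
    refine ContDiff.sum fun i _ => ContDiff.sum fun j _ => contDiff_const.mul (hf.comp ?_)
    exact contDiff_const.add (contDiff_const.mul contDiff_id)
  have hHpos : ∀ b, 0 ≤ b → 0 ≤ H b := by
    intro b hb
    have := (h b hb (m + 1)).dotProduct_mulVec_nonneg fun i => q.coeff i
    simp only [dotProduct, Matrix.mulVec, hankel_apply, star_trivial, Finset.mul_sum] at this
    refine this.trans_eq ?_
    refine Finset.sum_congr rfl fun i _ => Finset.sum_congr rfl fun j _ => ?_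
    rw [mul_comm b]
    ring
  have hder : ∀ r : ℕ, iteratedDeriv r H 0 = iteratedDeriv r f a * q.eval (u ^ r) ^ 2 := by
    intro r
    have hfa : ContDiff ℝ r fun z => f (a + z) :=
      (hf.comp (contDiff_const.add contDiff_id)).of_le (by exact_mod_cast le_top)
    have hg : ∀ i j : Fin (m + 1), ContDiff ℝ r
        fun b => q.coeff i * q.coeff j * f (a + u ^ ((i : ℕ) + j) * b) := fun i j =>
      contDiff_const.mul (hfa.comp (contDiff_const.mul contDiff_id))
    rw [hH, iteratedDeriv_fun_sum fun i _ => (ContDiff.sum fun j _ => hg i j).contDiffAt]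
    simp_rw [iteratedDeriv_fun_sum fun j _ => (hg _ j).contDiffAt, iteratedDeriv_const_mul_field]
    have e : ∀ i j : Fin (m + 1), iteratedDeriv r (fun b => f (a + u ^ ((i : ℕ) + j) * b)) 0 =
        (u ^ ((i : ℕ) + j)) ^ r * iteratedDeriv r f a := fun i j => by
      rw [iteratedDeriv_comp_const_mul (f := fun z => f (a + z)) hfa,
        iteratedDeriv_comp_const_add]
      simp
    simp_rw [e]
    rw [hqe, sq, Finset.sum_mul_sum, Finset.mul_sum]
    refine Finset.sum_congr rfl fun i _ => ?_
    rw [Finset.mul_sum]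
    refine Finset.sum_congr rfl fun j _ => ?_
    ring
  have := hsm.iteratedDeriv_nonneg_of_nonneg hHpos m fun r hr => by
    rw [hder, hq0 r hr]; simp
  rw [hder] at this
  exact nonneg_of_mul_nonneg_left this (by positivity)

end Bernstein

/-! ### From monotone to smooth functions and back -/

section Limit

open Filter MeasureTheory
open scoped ContDiff

/-- `G` preserves positive semidefiniteness of the Hankel matrices of the moment sequences of
`a δ₁ + b δᵤ`. -/
def PreservesTwoAtomHankel (G : ℝ → ℝ) : Prop :=
  ∀ a b u : ℝ, 0 ≤ a → 0 ≤ b → 0 ≤ u → ∀ n, (hankel (fun k => G (a + b * u ^ k)) n).PosSemidef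

/-- Smooth approximation from above by a one-sided mollification. -/
theorem PreservesTwoAtomHankel.exists_contDiff {G : ℝ → ℝ} (hG : Monotone G)
    (hW : PreservesTwoAtomHankel G) {δ : ℝ} (hδ : 0 < δ) :
    ∃ f : ℝ → ℝ, ContDiff ℝ ∞ f ∧ (∀ x, G x ≤ f x) ∧ (∀ x, f x ≤ G (x + 2 * δ)) ∧
      PreservesTwoAtomHankel f := by
  let φ : ContDiffBump (0 : ℝ) := ⟨δ / 2, δ, half_pos hδ, half_lt_self hδ⟩
  set w : ℝ → ℝ := φ.normed volume with hw
  have hw0 : ∀ t, 0 ≤ w t := φ.nonneg_normed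
  have hw1 : ∫ t, w t = 1 := φ.integral_normed
  have hwsupp : ∀ t, w t ≠ 0 → |t| < δ := by
    intro t ht
    have : t ∈ Function.support w := ht
    rw [hw, φ.support_normed_eq, Metric.mem_ball, dist_zero_right] at this
    exact this
  have hloc : LocallyIntegrable G volume := hG.locallyIntegrable
  have hint : ∀ y, Integrable fun t => w t * G (y - t) := fun y =>
    HasCompactSupport.convolutionExists_left (ContinuousLinearMap.mul ℝ ℝ)
      φ.hasCompactSupport_normed φ.continuous_normed hloc y
  have hwint : Integrable w := φ.integrable_normed
  have hsm : ContDiff ℝ ∞ (convolution w G (ContinuousLinearMap.mul ℝ ℝ) volume) :=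
    φ.hasCompactSupport_normed.contDiff_convolution_left _ (φ.contDiff_normed (n := ⊤)) hloc
  -- As `w` lives on `|t| < δ`, the shift by `δ` samples `G` only between `x` and `x + 2 * δ`. This
  -- gives both bounds and keeps `a + δ - t` non-negative in the preservation property.
  refine ⟨fun x => ∫ t, w t * G (x + δ - t), ?_, fun x => ?_, fun x => ?_, ?_⟩
  · exact hsm.comp (contDiff_id.add contDiff_const)
  · calc G x = ∫ t, w t * G x := by rw [integral_mul_const, hw1, one_mul]
      _ ≤ _ := by
        refine integral_mono (hwint.mul_const _) (hint _) fun t => ?_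
        by_cases ht : w t = 0
        · simp [ht]
        · exact mul_le_mul_of_nonneg_left (hG (by linarith [(abs_lt.1 (hwsupp t ht)).2])) (hw0 t)
  · calc _ ≤ ∫ t, w t * G (x + 2 * δ) := by
          refine integral_mono (hint _) (hwint.mul_const _) fun t => ?_
          by_cases ht : w t = 0
          · simp [ht]
          · exact mul_le_mul_of_nonneg_left (hG (by linarith [(abs_lt.1 (hwsupp t ht)).1]))
              (hw0 t)
      _ = _ := by rw [integral_mul_const, hw1, one_mul]
  · intro a b u ha hb hu n
    refine Matrix.PosSemidef.of_dotProduct_mulVec_nonneg (hankel_isHermitian _ _) fun x => ?_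
    have hform : star x ⬝ᵥ (hankel (fun k => ∫ t, w t * G (a + b * u ^ k + δ - t)) n).mulVec x =
        ∫ t, w t *
          (star x ⬝ᵥ (hankel (fun k => G (a + δ - t + b * u ^ k)) n).mulVec x) := by
      simp only [dotProduct, Matrix.mulVec, hankel_apply, Finset.mul_sum]
      have hI : ∀ i j : Fin n, Integrable fun t =>
          w t * (star x i * (G (a + δ - t + b * u ^ ((i : ℕ) + j)) * x j)) := fun i j => by
        convert ((hint (a + b * u ^ ((i : ℕ) + j) + δ)).const_mul (star x i)).mul_const (x j)
          using 2 with t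
        rw [show a + δ - t + b * u ^ ((i : ℕ) + j) = a + b * u ^ ((i : ℕ) + j) + δ - t by ring]
        ring
      rw [integral_finsetSum _ fun i _ => integrable_finsetSum _ fun j _ => hI i j]
      refine Finset.sum_congr rfl fun i _ => ?_
      rw [integral_finsetSum _ fun j _ => hI i j]
      refine Finset.sum_congr rfl fun j _ => ?_
      rw [← integral_mul_const, ← integral_const_mul]
      congr 1 with t
      rw [show a + δ - t + b * u ^ ((i : ℕ) + j) = a + b * u ^ ((i : ℕ) + j) + δ - t by ring]
      ring
    rw [hform]
    refine integral_nonneg fun t => ?_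
    by_cases ht : w t = 0
    · simp [ht]
    · exact mul_nonneg (hw0 t) ((hW (a + δ - t) b u
        (by linarith [(abs_lt.1 (hwsupp t ht)).2]) hb hu n).dotProduct_mulVec_nonneg x)

/-- Bernstein's theorem applied to the mollification; any fixed `u` in `(0, 1)` would serve in place
of `1 / 2`. -/
theorem PreservesTwoAtomHankel.exists_hasSum {G : ℝ → ℝ} (hG : Monotone G)
    (hW : PreservesTwoAtomHankel G) {δ : ℝ} (hδ : 0 < δ) :
    ∃ c : ℕ → ℝ, (∀ k, 0 ≤ c k) ∧ ∀ x, 0 ≤ x → ∃ y, HasSum (fun k => c k * x ^ k) y ∧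
      G x ≤ y ∧ y ≤ G (x + 2 * δ) := by
  obtain ⟨f, hf, h1, h2, h3⟩ := hW.exists_contDiff hG hδ
  have hpos : ∀ n x, 0 ≤ x → 0 ≤ iteratedDeriv n f x := fun n x hx =>
    hf.iteratedDeriv_nonneg_of_hankel (u := 1 / 2) (by norm_num) (by norm_num)
      (fun b hb n => h3 x b (1 / 2) hx hb (by norm_num) n) n
  exact ⟨fun k => iteratedDeriv k f 0 / k.factorial,
    fun k => div_nonneg (hpos k 0 le_rfl) (by positivity),
    fun x hx => ⟨f x, hf.hasSum_taylor_of_iteratedDeriv_nonneg hpos hx, h1 x, h2 x⟩⟩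

/-- Passing to the limit in power series with non-negative coefficients that approximate a
monotone function from above. -/
theorem exists_powerSeries_of_approx {G : ℝ → ℝ} (hG : Monotone G)
    (h : ∀ δ : ℝ, 0 < δ → ∃ c : ℕ → ℝ, (∀ k, 0 ≤ c k) ∧ ∀ x, 0 ≤ x →
      ∃ y, HasSum (fun k => c k * x ^ k) y ∧ G x ≤ y ∧ y ≤ G (x + 2 * δ)) :
    ∃ c : ℕ → ℝ, (∀ k, 0 ≤ c k) ∧ (∀ x, 0 ≤ x → Summable fun k => c k * x ^ k) ∧
      (∀ x, 0 ≤ x → G x ≤ ∑' k, c k * x ^ k) ∧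
      ∀ x y, 0 ≤ x → x < y → ∑' k, c k * x ^ k ≤ G y := by
  choose c hc hcs using fun n : ℕ => h (1 / ((n : ℝ) + 1)) (by positivity)
  have hle1 : ∀ n : ℕ, 1 / ((n : ℝ) + 1) ≤ 1 := fun n => by
    rw [div_le_one (by positivity)]
    linarith [Nat.cast_nonneg (α := ℝ) n]
  have hbd : ∀ n k x, 0 ≤ x → c n k * x ^ k ≤ G (x + 2) := by
    intro n k x hx
    obtain ⟨y, hy, -, hy2⟩ := hcs n x hx
    refine (le_hasSum hy k fun j _ => mul_nonneg (hc n j) (pow_nonneg hx j)).trans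
      (hy2.trans (hG ?_))
    linarith [hle1 n]
  -- Evaluating at `x = 1` confines all coefficients to one compact interval, so a subsequence
  -- converges coefficientwise.
  obtain ⟨d, hd, φ, hφ, hlim⟩ := (isCompact_univ_pi (s := fun _ : ℕ => Set.Icc (0 : ℝ) (G (1 + 2)))
    fun _ => isCompact_Icc).tendsto_subseq (x := c) fun n k _ =>
      ⟨hc n k, by simpa using hbd n k 1 zero_le_one⟩
  have hlimk : ∀ k, Tendsto (fun n => c (φ n) k) atTop (𝓝 (d k)) := fun k =>
    (tendsto_pi_nhds.1 hlim) k
  have hd0 : ∀ k, 0 ≤ d k := fun k => (hd k (Set.mem_univ k)).1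
  -- The bound at `2 * x` yields a geometric majorant at `x`, uniform in `n`, for dominated
  -- convergence.
  have hdom : ∀ n k x, 0 ≤ x → c n k * x ^ k ≤ G (2 * x + 2) * (1 / 2) ^ k := by
    intro n k x hx
    calc c n k * x ^ k = c n k * (2 * x) ^ k * (1 / 2) ^ k := by
          rw [mul_assoc, ← mul_pow]
          congr 2
          ring
      _ ≤ _ := mul_le_mul_of_nonneg_right (hbd n k _ (by positivity)) (by positivity)
  have hgeom : ∀ x, Summable fun k : ℕ => G (2 * x + 2) * (1 / 2 : ℝ) ^ k := fun x =>
    (summable_geometric_of_lt_one (by norm_num) (by norm_num)).mul_left _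
  have hlimx : ∀ x, 0 ≤ x → Tendsto (fun n => ∑' k, c (φ n) k * x ^ k) atTop
      (𝓝 (∑' k, d k * x ^ k)) := fun x hx => by
    refine tendsto_tsum_of_dominated_convergence (hgeom x)
      (fun k => (hlimk k).mul_const _) (Eventually.of_forall fun n k => ?_)
    rw [Real.norm_of_nonneg (mul_nonneg (hc _ k) (pow_nonneg hx k))]
    exact hdom _ k x hx
  refine ⟨d, hd0, fun x hx => ?_, fun x hx => ?_, fun x y hx hxy => ?_⟩
  · refine Summable.of_nonneg_of_le (fun k => mul_nonneg (hd0 k) (pow_nonneg hx k)) (fun k => ?_)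
      (hgeom x)
    exact le_of_tendsto ((hlimk k).mul_const _) (Eventually.of_forall fun n => hdom _ k x hx)
  · refine ge_of_tendsto (hlimx x hx) (Eventually.of_forall fun n => ?_)
    obtain ⟨z, hz, hz1, -⟩ := hcs (φ n) x hx
    rwa [hz.tsum_eq]
  · refine le_of_tendsto (hlimx x hx) ?_
    have ht : Tendsto (fun n => x + 2 * (1 / ((φ n : ℝ) + 1))) atTop (𝓝 x) := by
      have := ((tendsto_one_div_add_atTop_nhds_zero_nat (𝕜 := ℝ)).comp
        hφ.tendsto_atTop).const_mul 2 |>.const_add x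
      simpa using this
    filter_upwards [ht.eventually_le_const hxy] with n hn
    obtain ⟨z, hz, -, hz2⟩ := hcs (φ n) x hx
    rw [hz.tsum_eq]
    exact hz2.trans (hG hn)

/-- A monotone function preserving positive semidefiniteness of the Hankel matrices of two-atom
measures agrees on `(0, ∞)` with an absolutely monotonic entire function. -/
theorem PreservesTwoAtomHankel.exists_isAbsMonotonicEntire {G : ℝ → ℝ} (hG : Monotone G)
    (hW : PreservesTwoAtomHankel G) :
    ∃ g : ℂ → ℂ, IsAbsMonotonicEntire g ∧ G 0 ≤ (g 0).re ∧ ∀ x : ℝ, 0 < x → (G x : ℂ) = g x := by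
  obtain ⟨c, hc, hs, hlow, hup⟩ := exists_powerSeries_of_approx hG fun δ hδ =>
    hW.exists_hasSum hG hδ
  obtain ⟨g, hg, hgc⟩ := exists_isAbsMonotonicEntire_of_summable hc hs
  have hre : ∀ x : ℝ, 0 ≤ x → (g x).re = ∑' k, c k * x ^ k := fun x hx => by
    rw [hgc x hx, Complex.ofReal_re]
  refine ⟨g, hg, ?_, fun x hx => ?_⟩
  · have := hre 0 le_rfl
    rw [Complex.ofReal_zero] at this
    rw [this]
    exact hlow 0 le_rfl
  · rw [hgc x hx.le, Complex.ofReal_inj]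
    refine le_antisymm (hlow x hx.le) ?_
    have hcont : Continuous fun y : ℝ => (g y).re :=
      Complex.continuous_re.comp (hg.1.continuous.comp Complex.continuous_ofReal)
    rw [← hre x hx.le]
    -- The upper bound holds only at `y < x`; continuity of the series lets `y` increase to `x`. At
    -- `0` there is no such `y ≥ 0`, whence the possible jump.
    refine le_of_tendsto ((hcont.tendsto x).mono_left (nhdsWithin_le_nhds (s := Set.Iio x))) ?_
    filter_upwards [self_mem_nhdsWithin,
      mem_nhdsWithin_of_mem_nhds (lt_mem_nhds hx)] with y hy hy0
    rw [hre y hy0.le]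
    exact hup y x hy0.le hy

end Limit

/-! ### Two-atom sequences as test data -/

theorem hankel_twoAtom_posSemidef {a b u : ℝ} (ha : 0 ≤ a) (hb : 0 ≤ b) (n : ℕ) :
    (hankel (fun k => a + b * u ^ k) n).PosSemidef := by
  have h := (hankel_const_posSemidef ha n).add
    ((Matrix.posSemidef_vecMulVec_self_star (fun i : Fin n => u ^ (i : ℕ))).smul hb)
  convert h using 1
  ext i j
  simp [hankel_apply, Matrix.vecMulVec_apply, pow_add]

theorem hankel_twoAtom_isTotallyNonneg {a b u : ℝ} (ha : 0 ≤ a) (hb : 0 ≤ b) (hu : 0 ≤ u) (n : ℕ) :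
    IsTotallyNonneg (hankel (fun k => a + b * u ^ k) n) := by
  refine hankel_isTotallyNonneg (hankel_twoAtom_posSemidef ha hb n) ?_
  have := hankel_twoAtom_posSemidef (u := u) ha (mul_nonneg hb hu) (n - 1)
  simpa only [pow_succ', mul_assoc] using this

theorem twoAtom_mem_momentSet {a b u : ℝ} (ha : 0 ≤ a) (hb : 0 ≤ b) (hu : 0 ≤ u) :
    (fun k => a + b * u ^ k) ∈ momentSet (Set.Ici 0) := by
  refine mem_momentSet_Ici_iff.2 ⟨fun k => by positivity,
    ENNReal.ofReal a • MeasureTheory.Measure.dirac 1 +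
      ENNReal.ofReal b • MeasureTheory.Measure.dirac u.toNNReal, fun k => ?_⟩
  rw [MeasureTheory.lintegral_add_measure, MeasureTheory.lintegral_smul_measure,
    MeasureTheory.lintegral_smul_measure, MeasureTheory.lintegral_dirac,
    MeasureTheory.lintegral_dirac, ENNReal.ofReal_add ha (by positivity), ENNReal.ofReal_mul hb,
    ENNReal.ofReal_pow hu]
  simp [ENNReal.ofReal]

/-- The quadratic form at `x` is the integral of the square of the polynomial with coefficients `x`.
-/
theorem hankel_posSemidef_of_mem_momentSet {K : Set ℝ} {s : ℕ → ℝ} (hs : s ∈ momentSet K) (n : ℕ) :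
    (hankel s n).PosSemidef := by
  obtain ⟨μ, hμ, h⟩ := hs
  refine Matrix.PosSemidef.of_dotProduct_mulVec_nonneg (hankel_isHermitian _ _) fun x => ?_
  have hform : star x ⬝ᵥ (hankel s n).mulVec x = ∫ t, (∑ i, x i * t ^ (i : ℕ)) ^ 2 ∂μ := by
    have hI : ∀ i j : Fin n, MeasureTheory.Integrable
        (fun t : ℝ => x i * t ^ (i : ℕ) * (x j * t ^ (j : ℕ))) μ := fun i j => by
      convert (hμ.integrable_pow ((i : ℕ) + j)).const_mul (x i * x j) using 2 with t
      ring
    simp only [dotProduct, Matrix.mulVec, hankel_apply, star_trivial, sq, Finset.mul_sum,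
      Finset.sum_mul]
    rw [Finset.sum_comm, MeasureTheory.integral_finsetSum _ fun i _ =>
      MeasureTheory.integrable_finsetSum _ fun j _ => hI j i]
    refine Finset.sum_congr rfl fun i _ => ?_
    rw [MeasureTheory.integral_finsetSum _ fun j _ => hI j i]
    refine Finset.sum_congr rfl fun j _ => ?_
    rw [h, ← MeasureTheory.integral_mul_const, ← MeasureTheory.integral_const_mul]
    congr 1 with t
    ring
  rw [hform]
  exact MeasureTheory.integral_nonneg fun t => sq_nonneg _

/-! ### Consequences for `F` and the behaviour at `0` -/

section TwoAtom

variable {F : ℝ≥0 → ℝ}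

theorem preservesTwoAtomHankel_of_HTN
    (h : ∀ (n : ℕ), 1 ≤ n → ∀ (A : Matrix (Fin n) (Fin n) ℝ) (hA : A ∈ HTN n),
      (entrywise F A hA.2.entry_nonneg).PosSemidef) :
    PreservesTwoAtomHankel fun x => F x.toNNReal := by
  intro a b u ha hb hu n
  rcases Nat.eq_zero_or_pos n with rfl | hn
  · exact Matrix.PosSemidef.of_dotProduct_mulVec_nonneg (hankel_isHermitian _ _) fun x => by
      simp [dotProduct]
  · have := h n hn _ (hankel_mem_HTN (hankel_twoAtom_isTotallyNonneg ha hb hu n))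
    rwa [entrywise_hankel] at this

theorem preservesTwoAtomHankel_of_momentSet
    (h : ∀ (s : ℕ → ℝ) (hs : s ∈ momentSet (Set.Ici 0)),
      termwise F s (momentSet.term_nonneg hs) ∈ momentSet (Set.Ici 0)) :
    PreservesTwoAtomHankel fun x => F x.toNNReal := by
  intro a b u ha hb hu n
  have := hankel_posSemidef_of_mem_momentSet (h _ (twoAtom_mem_momentSet ha hb hu)) n
  rwa [funext (termwise_apply F _)] at this

theorem PreservesTwoAtomHankel.nonneg {G : ℝ → ℝ} (hW : PreservesTwoAtomHankel G) {a : ℝ}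
    (ha : 0 ≤ a) : 0 ≤ G a := by
  have := (hW a 0 0 ha le_rfl le_rfl 1).diag_nonneg (i := 0)
  simpa [hankel_apply] using this

/-- With `u = 0` and `0 ^ 0 = 1` the sequence is `a + b, a, a, …`, so the `2 × 2` determinant gives
`G a ^ 2 ≤ G (a + b) * G a`. -/
theorem PreservesTwoAtomHankel.le_add {G : ℝ → ℝ} (hW : PreservesTwoAtomHankel G) {a b : ℝ}
    (ha : 0 ≤ a) (hb : 0 ≤ b) : G a ≤ G (a + b) := by
  have := (hW a b 0 ha hb le_rfl 2).det_nonneg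
  rw [Matrix.det_fin_two] at this
  simp only [hankel_apply, Fin.val_zero, Fin.val_one, add_zero, zero_add, pow_zero, mul_one,
    pow_one, mul_zero, ne_eq, Nat.add_eq_zero_iff, one_ne_zero, and_self, not_false_eq_true,
    zero_pow] at this
  rcases (hW.nonneg ha).eq_or_lt with h0 | h0
  · rw [← h0]
    exact hW.nonneg (add_nonneg ha hb)
  · exact le_of_mul_le_mul_right (by linarith) h0

theorem PreservesTwoAtomHankel.monotone (hW : PreservesTwoAtomHankel fun x => F x.toNNReal) :
    Monotone fun x : ℝ => F x.toNNReal := by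
  intro x y hxy
  have hle := Real.toNNReal_le_toNNReal hxy
  have := hW.le_add (a := x.toNNReal) (b := (y.toNNReal : ℝ) - x.toNNReal) (NNReal.coe_nonneg _)
    (sub_nonneg.2 (by exact_mod_cast hle))
  simpa only [add_sub_cancel, Real.toNNReal_coe] using this

theorem exists_absMonotonicEntire_of_twoAtom
    (hW : PreservesTwoAtomHankel fun x => F x.toNNReal) :
    (∃ g : ℂ → ℂ, IsAbsMonotonicEntire g ∧
        ∀ x : ℝ≥0, 0 < x → ((F x : ℝ) : ℂ) = g ((x : ℝ) : ℂ)) ∧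
      0 ≤ F 0 ∧ ∃ L : ℝ, Filter.Tendsto F (𝓝[>] 0) (𝓝 L) ∧ F 0 ≤ L := by
  obtain ⟨g, hg, h0, hgF⟩ := hW.exists_isAbsMonotonicEntire hW.monotone
  have hgF' : ∀ x : ℝ≥0, 0 < x → ((F x : ℝ) : ℂ) = g ((x : ℝ) : ℂ) := fun x hx => by
    simpa using hgF x (by exact_mod_cast hx)
  refine ⟨⟨g, hg, hgF'⟩, by simpa using hW.nonneg le_rfl, (g 0).re, ?_, by simpa using h0⟩
  have hcont : Continuous fun y : ℝ≥0 => (g (y : ℝ)).re :=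
    Complex.continuous_re.comp (hg.1.continuous.comp
      (Complex.continuous_ofReal.comp NNReal.continuous_coe))
  have ht := (hcont.tendsto 0).mono_left (nhdsWithin_le_nhds (s := Set.Ioi 0))
  simp only [NNReal.coe_zero, Complex.ofReal_zero] at ht
  refine ht.congr' ?_
  filter_upwards [self_mem_nhdsWithin] with x hx
  rw [← hgF' x hx, Complex.ofReal_re]

/-- The right limit of `F` at `0` is the constant coefficient, which turns the limit condition into
`F 0 ≤ c 0`. -/
theorem exists_hasSum_of_absMonotonicEntire
    (h : (∃ g : ℂ → ℂ, IsAbsMonotonicEntire g ∧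
        ∀ x : ℝ≥0, 0 < x → ((F x : ℝ) : ℂ) = g ((x : ℝ) : ℂ)) ∧
      0 ≤ F 0 ∧ ∃ L : ℝ, Filter.Tendsto F (𝓝[>] 0) (𝓝 L) ∧ F 0 ≤ L) :
    ∃ c : ℕ → ℝ, (∀ k, 0 ≤ c k) ∧
      (∀ x : ℝ≥0, 0 < x → HasSum (fun k => c k * (x : ℝ) ^ k) (F x)) ∧ 0 ≤ F 0 ∧ F 0 ≤ c 0 := by
  obtain ⟨⟨g, hg, hgF⟩, h0, L, hL, hL0⟩ := h
  obtain ⟨c, hc, hc0, hcs⟩ := hg.exists_hasSum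
  refine ⟨c, hc, fun x hx => ?_, h0, ?_⟩
  · have := hcs x
    rwa [← hgF x hx, Complex.ofReal_re] at this
  · have hcont : Continuous fun y : ℝ≥0 => (g (y : ℝ)).re :=
      Complex.continuous_re.comp (hg.1.continuous.comp
        (Complex.continuous_ofReal.comp NNReal.continuous_coe))
    have ht := (hcont.tendsto 0).mono_left (nhdsWithin_le_nhds (s := Set.Ioi 0))
    simp only [NNReal.coe_zero, Complex.ofReal_zero] at ht
    rw [hc0, ← tendsto_nhds_unique hL (ht.congr' ?_)]
    · exact hL0
    · filter_upwards [self_mem_nhdsWithin] with x hx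
      rw [← hgF x hx, Complex.ofReal_re]

end TwoAtom

/-! ### The equivalence -/

theorem theorem2p6 (F : ℝ≥0 → ℝ) :
    List.TFAE [
      ∀ (n : ℕ), 1 ≤ n → ∀ (A : Matrix (Fin n) (Fin n) ℝ) (hA : A ∈ HTN n),
        (entrywise F A hA.2.entry_nonneg).PosSemidef,
      ∀ (n : ℕ), 1 ≤ n → ∀ (A : Matrix (Fin n) (Fin n) ℝ) (hA : A ∈ HTN n),
        entrywise F A hA.2.entry_nonneg ∈ HTN n,
      ∀ (s : ℕ → ℝ) (hs : s ∈ momentSet (Set.Ici 0)),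
        termwise F s (momentSet.term_nonneg hs) ∈ momentSet (Set.Ici 0),
      (∃ g : ℂ → ℂ, IsAbsMonotonicEntire g ∧
          ∀ x : ℝ≥0, 0 < x → ((F x : ℝ) : ℂ) = g ((x : ℝ) : ℂ)) ∧
        0 ≤ F 0 ∧ ∃ L : ℝ, Filter.Tendsto F (𝓝[>] 0) (𝓝 L) ∧ F 0 ≤ L] := by
  tfae_have 2 → 1 := fun h n hn A hA => posSemidef_of_mem_HTN (h n hn A hA)
  tfae_have 1 → 4 := fun h =>
    exists_absMonotonicEntire_of_twoAtom (preservesTwoAtomHankel_of_HTN h)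
  tfae_have 3 → 4 := fun h =>
    exists_absMonotonicEntire_of_twoAtom (preservesTwoAtomHankel_of_momentSet h)
  tfae_have 4 → 2 := fun h n _ A hA => by
    obtain ⟨c, hc, hF, h0, h0c⟩ := exists_hasSum_of_absMonotonicEntire h
    exact entrywise_mem_HTN hc hF h0 h0c A hA
  tfae_have 4 → 3 := fun h s hs => by
    obtain ⟨c, hc, hF, h0, h0c⟩ := exists_hasSum_of_absMonotonicEntire h
    exact termwise_mem_momentSet hc hF h0 h0c s hs
  tfae_finish
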